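/- **Theorem 2.3.** Let $m\ge 1$, let $\mathcal H$ be an infinite-dimensional complex Hilbert space, and let $T=(T_1,\dots,T_m)$ be an $m$-tuple of commuting bounded linear operators on $\mathcal H$. For a multi-index $n\in\mathbb N^m$ (where $0\in\mathbb N$) write $T^n=T_1^{n_1}\cdots T_m^{n_m}$, and let $\epsilon_j\in\mathbb N^m$ be the multi-index with $1$ in the $j$th place and zeros elsewhere. Assume that $T$ is *spherical*: for every unitary matrix $U=(u_{jk})\in\mathcal U(m)$ there is a unitary operator $\Gamma(U)$ on $\mathcal H$ such that $$\Gamma(U)\,T_j=\Big(\sum_{k=1}^m u_{jk}T_k\Big)\Gamma(U)\qquad(1\le j\le m).$$ Let $D_{T^*}:\mathcal H\to\mathcal H^{(m)}$, $h\mapsto(T_1^*h,\dots,T_m^*h)$, so that $\ker(D_{T^*})=\bigcap_{i=1}^m\ker T_i^*$. Then the following are equivalent. 1. $\ker(D_{T^*})$ is one-dimensional and is a cyclic subspace for $T$, that is, the closed linear span of $\{T^nx : x\in\ker(D_{T^*}),\ n\in\mathbb N^m\}$ is $\mathcal H$. 2. $T$ is unitarily equivalent to an $m$-variable weighted shift,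 that is, to a commuting $m$-tuple $S=(S_1,\dots,S_m)$ of bounded operators on a Hilbert space with an orthonormal basis $\{e_n\}_{n\in\mathbb N^m}$ such that $S_je_n=w^{(j)}_n e_{n+\epsilon_j}$ for all $n\in\mathbb N^m$ and $1\le j\le m$, with positive weights $w^{(j)}_n$. 3. There is a multi-sequence $\beta=\{\beta_n\}_{n\in\mathbb N^m}$ of positive numbers such that multiplication by each coordinate $z_1,\dots,z_m$ is a bounded operator from $H^2(\beta)$ to itself and $T$ is unitarily equivalent to the multiplication $m$-tuple $M_z=(M_{z_1},\dots,M_{z_m})$ on $H^2(\beta)$. Here $H^2(\beta)$ is the Hilbert space of formal power series $f(z)=\sum_{n\in\mathbb N^m}a_nz^n$ with complex coefficients such that $\|f\|_\beta^2=\sum_{n\in\mathbb N^m}|a_n|^2\beta_n^2<\infty$. Two $m$-tuples $T$ on $\mathcal H$ and $S$ on $\mathcal K$ are unitarily equivalent if there is a single unitary operator $V:\mathcal H\to\mathcal K$ with $VT_j=S_jV$ for all $1\le j\le m$. -/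

import Mathlib

open scoped ComplexConjugate

universe u v

noncomputable section

namespace SphericalTuple

section Tuples

variable {m : ℕ} {H : Type u} [NormedAddCommGroup H] [InnerProductSpace ℂ H]

/-- The operators of the tuple commute with each other. -/
def IsCommuting (T : Fin m → H →L[ℂ] H) : Prop :=
  ∀ i j, Commute (T i) (T j)

/-- The tuple `T_U`, `(T_U)_j = ∑ k, u_{jk} T_k`. -/
def rotate (U : Matrix (Fin m) (Fin m) ℂ) (T : Fin m → H →L[ℂ] H) : Fin m → H →L[ℂ] H :=
  fun j => ∑ k, U j k • T k

/-- `T` is spherical: for every unitary matrix `U` there is a unitary operator `Γ` on `H` with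
`Γ T_j = (T_U)_j Γ` for all `j`. No dependence of `Γ` on `U` is prescribed. -/
def IsSpherical (T : Fin m → H →L[ℂ] H) : Prop :=
  ∀ U : Matrix.unitaryGroup (Fin m) ℂ, ∃ Γ : H ≃ₗᵢ[ℂ] H,
    ∀ j x, Γ (T j x) = rotate (U : Matrix (Fin m) (Fin m) ℂ) T j (Γ x)

/-- The power `T^n = T_1^{n_1} ⋯ T_m^{n_m}` for a multi-index `n`. -/
def multiPow (T : Fin m → H →L[ℂ] H) (n : Fin m →₀ ℕ) : H →L[ℂ] H :=
  (List.ofFn fun i => T i ^ n i).prod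

/-- The map `D_T : H → H^(m)`, `h ↦ (T_1 h, …, T_m h)`, into the orthogonal sum of `m` copies. -/
def columnMap (T : Fin m → H →L[ℂ] H) : H →ₗ[ℂ] PiLp 2 (fun _ : Fin m => H) :=
  (WithLp.linearEquiv 2 ℂ (Fin m → H)).symm.toLinearMap ∘ₗ
    LinearMap.pi fun i => (T i : H →ₗ[ℂ] H)

/-- The adjoint tuple `T^* = (T_1^*, …, T_m^*)`. -/
def adjointTuple [CompleteSpace H] (T : Fin m → H →L[ℂ] H) : Fin m → H →L[ℂ] H :=
  fun i => ContinuousLinearMap.adjoint (T i)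

theorem mem_ker_columnMap (T : Fin m → H →L[ℂ] H) (h : H) :
    h ∈ LinearMap.ker (columnMap T) ↔ ∀ i, T i h = 0 := by
  simp [columnMap, funext_iff]

/-- The closed subspace `M` is cyclic for `T`: the closed linear span of the vectors `T^n x`
with `x ∈ M` is the whole space. -/
def IsCyclicSubspace (T : Fin m → H →L[ℂ] H) (M : Submodule ℂ H) : Prop :=
  IsClosed (M : Set H) ∧
    (Submodule.span ℂ {y | ∃ n : Fin m →₀ ℕ, ∃ x ∈ M, y = multiPow T n x}).topologicalClosure = ⊤

/-- `T` is an `m`-variable weighted shift: a commuting tuple with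
`T_j e_n = w_n^{(j)} e_{n + ε_j}` for an orthonormal (Hilbert) basis indexed by `ℕ^m` and
positive weights. -/
def IsWeightedShift (T : Fin m → H →L[ℂ] H) : Prop :=
  IsCommuting T ∧
    ∃ (e : HilbertBasis (Fin m →₀ ℕ) ℂ H) (w : Fin m → (Fin m →₀ ℕ) → ℝ),
      (∀ j n, 0 < w j n) ∧
      ∀ j n, T j (e n) = (w j n : ℂ) • e (n + Finsupp.single j 1)

/-- Unitary equivalence of tuples: one unitary intertwines all the coordinates. -/
def UnitarilyEquivalent {K : Type v} [NormedAddCommGroup K] [InnerProductSpace ℂ K]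
    (T : Fin m → H →L[ℂ] H) (S : Fin m → K →L[ℂ] K) : Prop :=
  ∃ V : H ≃ₗᵢ[ℂ] K, ∀ j x, V (T j x) = S j (V x)

end Tuples

section HTwo

variable {m : ℕ}

/-- The formal power series `∑ a_n z^n` with `∑ |a_n|² β_n² < ∞`. -/
def h2Submodule (β : (Fin m →₀ ℕ) → ℝ) : Submodule ℂ (MvPowerSeries (Fin m) ℂ) where
  carrier := {f | Summable fun n => ‖MvPowerSeries.coeff n f‖ ^ 2 * β n ^ 2}
  zero_mem' := by simp
  add_mem' := by
    intro f g hf hg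
    refine Summable.of_nonneg_of_le (fun n => by positivity) (fun n => ?_)
      ((hf.add hg).mul_left 2)
    rw [map_add, ← add_mul, ← mul_assoc]
    refine mul_le_mul_of_nonneg_right ?_ (sq_nonneg _)
    have h := norm_add_le (MvPowerSeries.coeff n f) (MvPowerSeries.coeff n g)
    nlinarith [sq_nonneg (‖MvPowerSeries.coeff n f‖ - ‖MvPowerSeries.coeff n g‖),
      norm_nonneg (MvPowerSeries.coeff n f + MvPowerSeries.coeff n g)]
  smul_mem' := by
    intro c f hf
    refine (Summable.mul_left (‖c‖ ^ 2) hf).congr fun n => ?_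
    rw [MvPowerSeries.coeff_smul, norm_mul]
    ring

/-- The space `H²(β)`, for a positive multi-sequence `β`. -/
def H2 (β : (Fin m →₀ ℕ) → ℝ) (_hβ : ∀ n, 0 < β n) : Type :=
  ↥(h2Submodule β)

namespace H2

variable {β : (Fin m →₀ ℕ) → ℝ} {hβ : ∀ n, 0 < β n}

instance : AddCommGroup (H2 β hβ) := inferInstanceAs (AddCommGroup ↥(h2Submodule β))

instance : Module ℂ (H2 β hβ) := inferInstanceAs (Module ℂ ↥(h2Submodule β))

/-- The formal power series underlying an element of `H²(β)`. -/
def series : H2 β hβ →ₗ[ℂ] MvPowerSeries (Fin m) ℂ := (h2Submodule β).subtype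

theorem series_injective : Function.Injective (series : H2 β hβ → MvPowerSeries (Fin m) ℂ) :=
  Subtype.val_injective

/-- The inner product `⟨f, g⟩ = ∑ conj (a_n) b_n β_n²` (conjugate-linear in the first variable,
as everywhere in Mathlib). -/
instance : Inner ℂ (H2 β hβ) where
  inner f g := ∑' n, conj (MvPowerSeries.coeff n (series f)) * MvPowerSeries.coeff n (series g) *
    ((β n : ℂ)) ^ 2

/-- The weighted coefficient sequence `(β_n a_n)`, as an element of `ℓ²(ℕ^m)`. -/
def toLp : H2 β hβ →ₗ[ℂ] lp (fun _ : Fin m →₀ ℕ => ℂ) 2 where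
  toFun f := ⟨fun n => (β n : ℂ) * MvPowerSeries.coeff n (series f), by
    refine memℓp_gen ?_
    have hf : Summable fun n => ‖MvPowerSeries.coeff n (series f)‖ ^ 2 * β n ^ 2 := f.2
    refine hf.congr fun n => ?_
    simp [mul_pow, mul_comm]⟩
  map_add' f g := by
    ext n
    exact mul_add _ _ _
  map_smul' c f := by
    ext n
    simp only [map_smul, lp.coeFn_smul, Pi.smul_apply, smul_eq_mul,
      RingHom.id_apply]
    ring

theorem toLp_apply (f : H2 β hβ) (n : Fin m →₀ ℕ) :
    toLp f n = (β n : ℂ) * MvPowerSeries.coeff n (series f) := rfl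

theorem inner_eq (f g : H2 β hβ) : inner ℂ f g = inner ℂ (toLp f) (toLp g) := by
  rw [lp.inner_eq_tsum]
  refine tsum_congr fun n => ?_
  rw [toLp_apply, toLp_apply, RCLike.inner_apply, map_mul, Complex.conj_ofReal]
  ring

theorem toLp_injective : Function.Injective (toLp : H2 β hβ → lp (fun _ : Fin m →₀ ℕ => ℂ) 2) := by
  intro f g h
  refine series_injective (MvPowerSeries.ext fun n => ?_)
  have hn := congrArg (fun a : lp (fun _ : Fin m →₀ ℕ => ℂ) 2 => a n) h
  simp only [toLp_apply] at hn
  exact mul_left_cancel₀ (Complex.ofReal_ne_zero.mpr (hβ n).ne') hn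

theorem toLp_surjective :
    Function.Surjective (toLp : H2 β hβ → lp (fun _ : Fin m →₀ ℕ => ℂ) 2) := by
  intro a
  have key : ∀ n, (β n : ℂ) ≠ 0 := fun n => Complex.ofReal_ne_zero.mpr (hβ n).ne'
  let p : MvPowerSeries (Fin m) ℂ := fun n => a n / (β n : ℂ)
  have hc : ∀ n, MvPowerSeries.coeff n p = a n / (β n : ℂ) := fun _ => rfl
  have hp : p ∈ h2Submodule β := by
    have ha := (lp.memℓp a).summable (by norm_num)
    refine ha.congr fun n => ?_
    have hn : ‖a n‖ ^ 2 = ‖MvPowerSeries.coeff n p‖ ^ 2 * β n ^ 2 := by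
      have h0 := (hβ n).ne'
      rw [hc, norm_div, Complex.norm_real, div_pow, Real.norm_eq_abs, sq_abs]
      field_simp
    rw [← hn]
    norm_num
  refine ⟨⟨p, hp⟩, lp.ext (funext fun n => ?_)⟩
  change (β n : ℂ) * MvPowerSeries.coeff n p = a n
  rw [hc]
  field_simp [key n]

/-- The inner product axioms for `H²(β)`. -/
@[reducible] def core (β : (Fin m →₀ ℕ) → ℝ) (hβ : ∀ n, 0 < β n) : InnerProductSpace.Core ℂ (H2 β hβ) where
  inner := inner ℂ
  conj_inner_symm f g := by
    rw [inner_eq, inner_eq]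
    exact inner_conj_symm _ _
  re_inner_nonneg f := by
    rw [inner_eq]
    exact inner_self_nonneg
  add_left f g h := by
    simp only [inner_eq, map_add, inner_add_left]
  smul_left f g c := by
    simp only [inner_eq, map_smul, inner_smul_left]
  definite f hf := by
    rw [inner_eq, inner_self_eq_zero] at hf
    exact toLp_injective (hf.trans (map_zero toLp).symm)

instance : NormedAddCommGroup (H2 β hβ) := (core β hβ).toNormedAddCommGroup

instance : InnerProductSpace ℂ (H2 β hβ) := InnerProductSpace.ofCore (core β hβ).toCore

theorem norm_toLp (f : H2 β hβ) : ‖toLp f‖ = ‖f‖ := by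
  rw [@norm_eq_sqrt_re_inner ℂ, @norm_eq_sqrt_re_inner ℂ _ _ _ _ f]
  exact congrArg (fun z : ℂ => √(RCLike.re z)) (inner_eq f f).symm

theorem norm_sq_eq (f : H2 β hβ) :
    ‖f‖ ^ 2 = ∑' n, ‖MvPowerSeries.coeff n (series f)‖ ^ 2 * β n ^ 2 := by
  rw [← norm_toLp]
  have h := lp.norm_rpow_eq_tsum (p := 2) (by norm_num) (toLp f)
  norm_num at h
  rw [h]
  refine tsum_congr fun n => ?_
  rw [toLp_apply, norm_mul, Complex.norm_real, mul_pow, Real.norm_eq_abs, sq_abs, mul_comm]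

/-- The unitary `f ↦ (β_n a_n)` from `H²(β)` onto `ℓ²(ℕ^m)`. -/
def toLpEquiv : H2 β hβ ≃ₗᵢ[ℂ] lp (fun _ : Fin m →₀ ℕ => ℂ) 2 :=
  ⟨LinearEquiv.ofBijective toLp ⟨toLp_injective, toLp_surjective⟩, norm_toLp⟩

instance : CompleteSpace (H2 β hβ) :=
  (completeSpace_congr (e := (toLpEquiv (β := β) (hβ := hβ)).toEquiv)
    (toLpEquiv (β := β) (hβ := hβ)).isometry.isUniformEmbedding).mpr inferInstance

end H2

/-- `M` is the tuple `M_z = (M_{z_1}, …, M_{z_m})` of (everywhere defined, bounded) multiplications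
by the coordinate functions on `H²(β)`. -/
def IsMultiplicationTuple {β : (Fin m →₀ ℕ) → ℝ} {hβ : ∀ n, 0 < β n}
    (M : Fin m → H2 β hβ →L[ℂ] H2 β hβ) : Prop :=
  ∀ j f, H2.series (M j f) = MvPowerSeries.X j * H2.series f

end HTwo

end SphericalTuple

end

namespace SphericalTuple

/-! The substance is that a spherical tuple with one-dimensional cyclic kernel `ℂx` is a weighted
shift. The unitaries `Γ(U)` preserve this kernel, so `x` is an eigenvector of each of them
(`IsSpherical.isSemiInvariant`). Diagonal `U` then make the vectors `T^n x` pairwise orthogonal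
(`IsSemiInvariant.inner_multiPow_eq_zero`).

None of them vanishes. If `T^n x = 0`, take `U` without zero entries: then `(T_U)^n x = 0`, and its
component along `T_i^{|n|} x` has a nonzero coefficient, so by orthogonality `T_i^{|n|} x = 0` for
every `i`. Only finitely many `T^k x` survive, and cyclicity makes `H` finite-dimensional
(`IsSemiInvariant.multiPow_ne_zero`). Normalizing the orbit gives the basis of the shift.

A weighted shift becomes `M_z` on `H²(β)` with `β_n = ‖T^n e_0‖`. Conversely `M_z` shifts the basis
`z^n / β_n`, and for a shift the kernel of `D_{T^*}` is `ℂe_0`, whose orbit consists of positive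
multiples of the basis vectors. -/

theorem multiIndex_induction {σ : Type*} {p : (σ →₀ ℕ) → Prop} (n : σ →₀ ℕ) (zero : p 0)
    (add_single : ∀ n j, p n → p (n + Finsupp.single j 1)) : p n := by
  -- The starting point `g` is left free so that the additive case can chain its two hypotheses.
  have key : ∀ g, p g → p (g + n) := by
    induction n using Finsupp.induction_linear with
    | zero => intro g hg; simpa using hg
    | add f₁ f₂ h₁ h₂ =>
      intro g hg
      rw [← add_assoc]
      exact h₂ _ (h₁ _ hg)
    | single j b =>
      induction b with
      | zero => intro g hg; simpa using hg
      | succ b ih =>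
        intro g hg
        rw [Finsupp.single_add, ← add_assoc]
        exact add_single _ _ (ih _ hg)
  simpa using key 0 zero

theorem exists_eq_add_single {σ : Type*} {n : σ →₀ ℕ} {j : σ} (h : n j ≠ 0) :
    ∃ k, n = k + Finsupp.single j 1 := by
  refine ⟨n - Finsupp.single j 1, (tsub_add_cancel_of_le ?_).symm⟩
  rw [Finsupp.single_le_iff]
  exact Nat.one_le_iff_ne_zero.mpr h

/-! ### Powers of commuting tuples -/

section Hilbert

variable {m : ℕ} {H : Type u} [NormedAddCommGroup H] [InnerProductSpace ℂ H]

theorem multiPow_zero (T : Fin m → H →L[ℂ] H) : multiPow T 0 = 1 := by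
  simp [multiPow, List.ofFn_const]

/-- The ordered product can be rearranged inside the submonoid generated by the `T i`, which is
commutative, so that `Finset` products are available there. -/
theorem IsCommuting.multiPow_add_single {T : Fin m → H →L[ℂ] H} (hT : IsCommuting T)
    (n : Fin m →₀ ℕ) (j : Fin m) :
    multiPow T (n + Finsupp.single j 1) = T j * multiPow T n := by
  have hM : IsMulCommutative (Submonoid.closure (Set.range T)) :=
    Submonoid.isMulCommutative_closure _ (by
      rintro _ ⟨i, rfl⟩ _ ⟨k, rfl⟩
      exact hT i k)
  let : CommMonoid (Submonoid.closure (Set.range T)) :=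
    { (inferInstance : Monoid (Submonoid.closure (Set.range T))) with
      mul_comm := hM.is_comm.comm }
  let t : Fin m → Submonoid.closure (Set.range T) :=
    fun i => ⟨T i, Submonoid.subset_closure ⟨i, rfl⟩⟩
  have key : ∀ k : Fin m →₀ ℕ, multiPow T k = ((∏ i, t i ^ k i :) : H →L[ℂ] H) := by
    intro k
    rw [← List.prod_ofFn]
    refine Eq.trans ?_ (map_list_prod (Submonoid.closure (Set.range T)).subtype _).symm
    rw [List.map_ofFn]
    rfl
  have hprod : (∏ i, t i ^ (n + Finsupp.single j 1 : Fin m →₀ ℕ) i) = t j * ∏ i, t i ^ n i := by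
    simp only [Finsupp.add_apply, pow_add, Finset.prod_mul_distrib]
    rw [mul_comm, Finset.prod_eq_single j]
    · simp
    · intro i _ hi
      simp [hi.symm]
    · simp
  rw [key, key, hprod]
  rfl

theorem IsCommuting.multiPow_add_single_apply {T : Fin m → H →L[ℂ] H} (hT : IsCommuting T)
    (n : Fin m →₀ ℕ) (j : Fin m) (x : H) :
    multiPow T (n + Finsupp.single j 1) x = T j (multiPow T n x) := by
  rw [hT.multiPow_add_single]
  rfl

theorem IsCommuting.rotate {T : Fin m → H →L[ℂ] H} (hT : IsCommuting T)
    (U : Matrix (Fin m) (Fin m) ℂ) : IsCommuting (rotate U T) := by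
  intro i j
  refine Commute.sum_left _ _ _ fun k _ => Commute.sum_right _ _ _ fun l _ => ?_
  exact ((hT k l).smul_left _).smul_right _

theorem rotate_apply (U : Matrix (Fin m) (Fin m) ℂ) (T : Fin m → H →L[ℂ] H) (j : Fin m) (x : H) :
    rotate U T j x = ∑ k, U j k • T k x := by
  simp [rotate]

theorem multiPow_intertwine {T S : Fin m → H →L[ℂ] H} (hT : IsCommuting T) (hS : IsCommuting S)
    (Γ : H ≃ₗᵢ[ℂ] H) (hΓ : ∀ j x, Γ (T j x) = S j (Γ x)) (n : Fin m →₀ ℕ) (x : H) :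
    Γ (multiPow T n x) = multiPow S n (Γ x) := by
  induction n using multiIndex_induction with
  | zero => simp [multiPow_zero]
  | add_single n j ih =>
    rw [hT.multiPow_add_single_apply, hS.multiPow_add_single_apply, hΓ, ih]

/-- A vector killed by one power `T^n` is killed by every larger power. -/
theorem IsCommuting.multiPow_add_eq_zero {T : Fin m → H →L[ℂ] H} (hT : IsCommuting T)
    {n : Fin m →₀ ℕ} {x : H} (h : multiPow T n x = 0) (k : Fin m →₀ ℕ) :
    multiPow T (n + k) x = 0 := by
  induction k using multiIndex_induction with
  | zero => simpa using h
  | add_single k j ih => rw [← add_assoc, hT.multiPow_add_single_apply, ih, map_zero]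

theorem IsWeightedShift.of_unitarilyEquivalent {K : Type v} [NormedAddCommGroup K]
    [InnerProductSpace ℂ K] {T : Fin m → H →L[ℂ] H} {S : Fin m → K →L[ℂ] K}
    (hT : IsCommuting T) (hS : IsWeightedShift S) (h : UnitarilyEquivalent T S) :
    IsWeightedShift T := by
  obtain ⟨V, hV⟩ := h
  obtain ⟨-, e, w, hw, he⟩ := hS
  have hVe : ∀ n, (HilbertBasis.ofRepr (V.trans e.repr)) n = V.symm (e n) := by
    classical
    intro n
    rw [← HilbertBasis.repr_symm_single, ← HilbertBasis.repr_symm_single]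
    rfl
  refine ⟨hT, HilbertBasis.ofRepr (V.trans e.repr), w, hw, fun j n => V.injective ?_⟩
  rw [hVe, hVe, hV, map_smul, V.apply_symm_apply, V.apply_symm_apply, he]

section Complete

variable [CompleteSpace H]

theorem mem_ker_columnMap_adjointTuple (T : Fin m → H →L[ℂ] H) (y : H) :
    y ∈ LinearMap.ker (columnMap (adjointTuple T)) ↔ ∀ j x, inner ℂ (T j x) y = 0 := by
  rw [mem_ker_columnMap]
  refine forall_congr' fun j => ⟨fun h x => ?_, fun h => ?_⟩
  · rw [← ContinuousLinearMap.adjoint_inner_right]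
    change inner ℂ x (adjointTuple T j y) = 0
    rw [h, inner_zero_right]
  · refine ext_inner_left ℂ fun x => ?_
    rw [inner_zero_right, ← h x]
    exact ContinuousLinearMap.adjoint_inner_right _ _ _

end Complete

/-! ### Weighted shifts: coordinates, kernel and cyclicity -/

namespace IsWeightedShift

variable {T : Fin m → H →L[ℂ] H} {e : HilbertBasis (Fin m →₀ ℕ) ℂ H}
  {w : Fin m → (Fin m →₀ ℕ) → ℝ}

/-- Both sides are continuous linear in `y`, so it suffices to compare them on the basis. Avoiding
the adjoint of `T j` makes completeness of `H` unnecessary. -/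
theorem inner_add_single (he : ∀ j n, T j (e n) = (w j n : ℂ) • e (n + Finsupp.single j 1))
    (j : Fin m) (n : Fin m →₀ ℕ) (y : H) :
    inner ℂ (e (n + Finsupp.single j 1)) (T j y) = w j n * inner ℂ (e n) y := by
  have hd : Dense (Submodule.span ℂ (Set.range e) : Set H) := by
    rw [Submodule.dense_iff_topologicalClosure_eq_top]
    exact e.dense_span
  have h : (innerSL ℂ (e (n + Finsupp.single j 1))).comp (T j) =
      (w j n : ℂ) • innerSL ℂ (e n) := by
    refine ContinuousLinearMap.ext_on hd ?_
    rintro _ ⟨k, rfl⟩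
    have ho := orthonormal_iff_ite.mp e.orthonormal
    simp only [ContinuousLinearMap.comp_apply, smul_apply, innerSL_apply_apply,
      he, inner_smul_right, ho, add_left_inj, smul_eq_mul]
    split_ifs with hnk
    · rw [hnk]
    · simp
  exact congrArg (fun f : H →L[ℂ] ℂ => f y) h

theorem inner_of_apply_eq_zero
    (he : ∀ j n, T j (e n) = (w j n : ℂ) • e (n + Finsupp.single j 1))
    (j : Fin m) {n : Fin m →₀ ℕ} (hn : n j = 0) (y : H) : inner ℂ (e n) (T j y) = 0 := by
  have hd : Dense (Submodule.span ℂ (Set.range e) : Set H) := by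
    rw [Submodule.dense_iff_topologicalClosure_eq_top]
    exact e.dense_span
  have h : (innerSL ℂ (e n)).comp (T j) = 0 := by
    refine ContinuousLinearMap.ext_on hd ?_
    rintro _ ⟨k, rfl⟩
    have hne : n ≠ k + Finsupp.single j 1 := by
      rintro rfl
      simp at hn
    simp [he, orthonormal_iff_ite.mp e.orthonormal, hne]
  exact congrArg (fun f : H →L[ℂ] ℂ => f y) h

theorem multiPow_apply_basis_zero (hT : IsCommuting T) (hw : ∀ j n, 0 < w j n)
    (he : ∀ j n, T j (e n) = (w j n : ℂ) • e (n + Finsupp.single j 1)) (n : Fin m →₀ ℕ) :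
    0 < ‖multiPow T n (e 0)‖ ∧ multiPow T n (e 0) = (‖multiPow T n (e 0)‖ : ℂ) • e n := by
  obtain ⟨c, hc, h⟩ : ∃ c : ℝ, 0 < c ∧ multiPow T n (e 0) = (c : ℂ) • e n := by
    induction n using multiIndex_induction with
    | zero => exact ⟨1, one_pos, by simp [multiPow_zero]⟩
    | add_single n j ih =>
      obtain ⟨c, hc, h⟩ := ih
      refine ⟨c * w j n, mul_pos hc (hw j n), ?_⟩
      rw [hT.multiPow_add_single_apply, h, map_smul, he, smul_smul, Complex.ofReal_mul]
  have hnorm : ‖multiPow T n (e 0)‖ = c := by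
    rw [h, norm_smul, e.orthonormal.1, Complex.norm_real, Real.norm_of_nonneg hc.le, mul_one]
  rw [hnorm]
  exact ⟨hc, h⟩

/-- The kernel is the orthogonal complement of the ranges of all `T j`. These ranges contain every
`e n` with `n ≠ 0` and are orthogonal to `e 0`. -/
theorem finrank_ker_and_isCyclicSubspace [CompleteSpace H] (h : IsWeightedShift T) :
    Module.finrank ℂ (LinearMap.ker (columnMap (adjointTuple T))) = 1 ∧
      IsCyclicSubspace T (LinearMap.ker (columnMap (adjointTuple T))) := by
  obtain ⟨hT, e, w, hw, he⟩ := h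
  have hker : LinearMap.ker (columnMap (adjointTuple T)) = Submodule.span ℂ {e 0} := by
    ext y
    rw [mem_ker_columnMap_adjointTuple]
    constructor
    · intro hy
      have h0 : ∀ n, n ≠ 0 → e.repr y n = 0 := by
        intro n hn
        obtain ⟨j, hj⟩ := Finsupp.ne_iff.mp hn
        obtain ⟨k, rfl⟩ := exists_eq_add_single hj
        have := hy j (e k)
        rw [he, inner_smul_left, mul_eq_zero] at this
        rw [e.repr_apply_apply]
        refine this.resolve_left ?_
        simpa using (hw j k).ne'
      have hs := (e.hasSum_repr y).unique (hasSum_single 0 fun n hn => by rw [h0 n hn, zero_smul])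
      rw [hs]
      exact Submodule.smul_mem _ _ (Submodule.mem_span_singleton_self _)
    · intro hy j x
      obtain ⟨c, rfl⟩ := Submodule.mem_span_singleton.mp hy
      rw [inner_smul_right, ← inner_conj_symm, inner_of_apply_eq_zero he j (by simp), map_zero,
        mul_zero]
  rw [hker]
  refine ⟨finrank_span_singleton (e.orthonormal.ne_zero 0), Submodule.closed_of_finiteDimensional _,
    ?_⟩
  rw [eq_top_iff, ← e.dense_span]
  refine Submodule.topologicalClosure_mono (Submodule.span_le.mpr ?_)
  rintro _ ⟨n, rfl⟩
  obtain ⟨hpos, hn⟩ := multiPow_apply_basis_zero hT hw he n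
  have hmem : multiPow T n (e 0) ∈ Submodule.span ℂ
      {y | ∃ n : Fin m →₀ ℕ, ∃ x ∈ Submodule.span ℂ {e 0}, y = multiPow T n x} :=
    Submodule.subset_span ⟨n, e 0, Submodule.mem_span_singleton_self _, rfl⟩
  rw [hn] at hmem
  exact (Submodule.smul_mem_iff _ (Complex.ofReal_ne_zero.mpr hpos.ne')).mp hmem

end IsWeightedShift

/-! ### Weighted shifts as multiplication tuples on `H²(β)` -/

namespace H2

variable {β : (Fin m →₀ ℕ) → ℝ} {hβ : ∀ n, 0 < β n}

theorem coeff_series_toLpEquiv_symm (a : lp (fun _ : Fin m →₀ ℕ => ℂ) 2) (n : Fin m →₀ ℕ) :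
    MvPowerSeries.coeff n (series ((toLpEquiv (β := β) (hβ := hβ)).symm a)) = a n / β n := by
  have h := toLp_apply ((toLpEquiv (β := β) (hβ := hβ)).symm a) n
  have h' : toLp ((toLpEquiv (β := β) (hβ := hβ)).symm a) = a :=
    (toLpEquiv (β := β) (hβ := hβ)).apply_symm_apply a
  rw [h'] at h
  rw [h, mul_div_cancel_left₀]
  exact Complex.ofReal_ne_zero.mpr (hβ n).ne'

end H2

theorem coeff_add_single_X_mul (f : MvPowerSeries (Fin m) ℂ) (j : Fin m) (n : Fin m →₀ ℕ) :
    MvPowerSeries.coeff (n + Finsupp.single j 1) (MvPowerSeries.X j * f) =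
      MvPowerSeries.coeff n f := by
  rw [add_comm, MvPowerSeries.X, MvPowerSeries.coeff_add_monomial_mul, one_mul]

theorem coeff_X_mul_of_apply_eq_zero (f : MvPowerSeries (Fin m) ℂ) (j : Fin m) {n : Fin m →₀ ℕ}
    (hn : n j = 0) : MvPowerSeries.coeff n (MvPowerSeries.X j * f) = 0 := by
  classical
  rw [MvPowerSeries.X, MvPowerSeries.coeff_monomial_mul, if_neg]
  rw [Finsupp.single_le_iff, hn]
  simp

theorem IsWeightedShift.exists_isMultiplicationTuple {T : Fin m → H →L[ℂ] H}
    (h : IsWeightedShift T) :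
    ∃ (β : (Fin m →₀ ℕ) → ℝ) (hβ : ∀ n, 0 < β n) (M : Fin m → H2 β hβ →L[ℂ] H2 β hβ),
      IsMultiplicationTuple M ∧ UnitarilyEquivalent T M := by
  obtain ⟨hT, e, w, hw, he⟩ := h
  -- Forced up to scale: the unitary must send `e n` to `z^n / β n`, so multiplication by `z_j` has
  -- weight `β (n + ε_j) / β n`.
  let β : (Fin m →₀ ℕ) → ℝ := fun n => ‖multiPow T n (e 0)‖
  have hβ : ∀ n, 0 < β n := fun n => (multiPow_apply_basis_zero hT hw he n).1
  have hβw : ∀ j n, β (n + Finsupp.single j 1) = w j n * β n := by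
    intro j n
    change ‖multiPow T _ (e 0)‖ = _
    rw [hT.multiPow_add_single_apply, (multiPow_apply_basis_zero hT hw he n).2, map_smul, he, norm_smul,
      norm_smul, e.orthonormal.1, Complex.norm_real, Complex.norm_real, norm_norm,
      Real.norm_of_nonneg (hw j n).le]
    ring
  let V : H ≃ₗᵢ[ℂ] H2 β hβ := e.repr.trans H2.toLpEquiv.symm
  have hV : ∀ y n, MvPowerSeries.coeff n (H2.series (V y)) = inner ℂ (e n) y / β n := by
    intro y n
    rw [← e.repr_apply_apply]
    exact H2.coeff_series_toLpEquiv_symm _ _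
  let M : Fin m → H2 β hβ →L[ℂ] H2 β hβ := fun j =>
    (V : H →L[ℂ] H2 β hβ) ∘L T j ∘L (V.symm : H2 β hβ →L[ℂ] H)
  have hM : ∀ j x, V (T j x) = M j (V x) := by
    intro j x
    simp [M]
  refine ⟨β, hβ, M, fun j f => ?_, V, hM⟩
  obtain ⟨y, rfl⟩ := V.surjective f
  rw [← hM]
  ext n
  rw [hV]
  by_cases hn : n j = 0
  · rw [inner_of_apply_eq_zero he j hn, zero_div, coeff_X_mul_of_apply_eq_zero _ _ hn]
  · obtain ⟨k, rfl⟩ := exists_eq_add_single hn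
    rw [inner_add_single he, coeff_add_single_X_mul, hV, hβw, Complex.ofReal_mul,
      mul_div_mul_left]
    exact Complex.ofReal_ne_zero.mpr (hw j k).ne'

/-- The standard basis of `ℓ²` pulls back to the monomials `z^n / β n`, which multiplication by
`z_j` shifts. -/
theorem IsMultiplicationTuple.isWeightedShift {β : (Fin m →₀ ℕ) → ℝ} {hβ : ∀ n, 0 < β n}
    {M : Fin m → H2 β hβ →L[ℂ] H2 β hβ} (hM : IsMultiplicationTuple M) : IsWeightedShift M := by
  classical
  refine ⟨fun i j => ?_, HilbertBasis.ofRepr H2.toLpEquiv,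
    fun j n => β (n + Finsupp.single j 1) / β n, fun j n => div_pos (hβ _) (hβ _), fun j n => ?_⟩
  · ext f : 1
    refine H2.series_injective ?_
    change H2.series (M i (M j f)) = H2.series (M j (M i f))
    rw [hM, hM, hM, hM, mul_left_comm]
  · have hcoeff : ∀ n k, MvPowerSeries.coeff k (H2.series
        ((HilbertBasis.ofRepr (H2.toLpEquiv (β := β) (hβ := hβ))) n)) =
          if k = n then (1 : ℂ) / β n else 0 := by
      intro n k
      rw [← HilbertBasis.repr_symm_single]
      refine (H2.coeff_series_toLpEquiv_symm _ _).trans ?_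
      rw [lp.single_apply]
      split_ifs with h
      · subst h; simp
      · simp [h]
    have h0 : ∀ n, (β n : ℂ) ≠ 0 := fun n => Complex.ofReal_ne_zero.mpr (hβ n).ne'
    refine H2.series_injective (MvPowerSeries.ext fun k => ?_)
    rw [hM, map_smul, MvPowerSeries.coeff_smul, hcoeff]
    by_cases hk : k j = 0
    · rw [coeff_X_mul_of_apply_eq_zero _ _ hk, if_neg, mul_zero]
      rintro rfl
      simp at hk
    · obtain ⟨l, rfl⟩ := exists_eq_add_single hk
      rw [coeff_add_single_X_mul, hcoeff]
      simp only [add_left_inj]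
      split_ifs with h
      · subst h
        have := h0 l
        have := h0 (l + Finsupp.single j 1)
        push_cast
        field_simp
      · simp

end Hilbert

/-! ### Special unitary matrices and phases -/

section Unitary

variable {m : ℕ}

theorem exists_mem_unitaryGroup_forall_ne_zero (m : ℕ) :
    ∃ U : Matrix.unitaryGroup (Fin m) ℂ, ∀ i j, (U : Matrix (Fin m) (Fin m) ℂ) i j ≠ 0 := by
  rcases Nat.eq_zero_or_pos m with rfl | hm
  · exact ⟨1, fun i => i.elim0⟩
  have hm' : (m : ℂ) ≠ 0 := Nat.cast_ne_zero.mpr hm.ne'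
  let J : Matrix (Fin m) (Fin m) ℂ := Matrix.of fun _ _ => 1
  have hJJ : J * J = (m : ℂ) • J := by
    ext i j
    simp [J, Matrix.mul_apply]
  have hJ : star J = J := by
    ext i j
    simp [J, Matrix.star_apply]
  -- With this `c`, `1 - c • J` has eigenvalue `1 - cm = i` on the all-ones vector and `1` on its
  -- complement, hence is unitary. Every entry has imaginary part `1/m`, hence is nonzero.
  let c : ℂ := (1 - Complex.I) / m
  have hc : star c = (1 + Complex.I) / m := by
    simp [c, sub_neg_eq_add]
  refine ⟨⟨1 - c • J, ?_⟩, fun i j h => ?_⟩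
  · have hscalar : star c * c * m - star c - c = 0 := by
      rw [hc]
      simp only [c]
      field_simp
      ring_nf
      simp
    rw [Matrix.mem_unitaryGroup_iff', star_sub, star_one, star_smul, hJ]
    have : (1 - star c • J) * (1 - c • J) = 1 + (star c * c * m - star c - c) • J := by
      simp only [mul_sub, sub_mul, one_mul, mul_one, smul_mul_assoc, mul_smul_comm, hJJ]
      module
    rw [this, hscalar, zero_smul, add_zero]
  · have him := congrArg Complex.im h
    have hcim : c.im = -1 / m := by
      simp [c]
    have h1 : ((1 : Matrix (Fin m) (Fin m) ℂ) i j).im = 0 := by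
      rw [Matrix.one_apply]
      split_ifs <;> simp
    simp [J, h1, hcim, hm.ne'] at him

theorem diagonal_mem_unitaryGroup {d : Fin m → ℂ} (hd : ∀ i, star (d i) * d i = 1) :
    Matrix.diagonal d ∈ Matrix.unitaryGroup (Fin m) ℂ := by
  rw [Matrix.mem_unitaryGroup_iff', Matrix.star_eq_conjTranspose, Matrix.diagonal_conjTranspose,
    Matrix.diagonal_mul_diagonal, ← Matrix.diagonal_one]
  exact congrArg _ (funext hd)

theorem exists_conj_mul_self_eq_one_and_conj_pow_mul_pow_ne_one {a b : ℕ} (h : a ≠ b) :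
    ∃ ζ : ℂ, conj ζ * ζ = 1 ∧ conj (ζ ^ a) * ζ ^ b ≠ 1 := by
  have hd : (b : ℂ) - a ≠ 0 := sub_ne_zero.mpr fun h' => h (Nat.cast_injective h').symm
  -- The product of the two powers is `exp (i(b - a)θ)`, which this angle makes equal to `-1`.
  let θ : ℝ := Real.pi / (b - a)
  refine ⟨Complex.exp (θ * Complex.I), ?_, ?_⟩
  · rw [← Complex.exp_conj, ← Complex.exp_add]
    simp
  · have : conj (Complex.exp (θ * Complex.I) ^ a) * Complex.exp (θ * Complex.I) ^ b = -1 := by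
      rw [← Complex.exp_nat_mul, ← Complex.exp_nat_mul, ← Complex.exp_conj, ← Complex.exp_add,
        ← Complex.exp_pi_mul_I]
      congr 1
      simp only [θ, map_mul, Complex.conj_ofReal, Complex.conj_I, map_natCast]
      push_cast
      field_simp
      ring
    rw [this]
    norm_num

end Unitary

/-! ### Rotated powers modulo the off-axis orbit -/

section Hilbert

variable {m : ℕ} {H : Type u} [NormedAddCommGroup H] [InnerProductSpace ℂ H]

theorem multiPow_rotate_diagonal_update {T : Fin m → H →L[ℂ] H} (hT : IsCommuting T) (j : Fin m)
    (ζ : ℂ) (n : Fin m →₀ ℕ) (x : H) :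
    multiPow (rotate (Matrix.diagonal (Function.update 1 j ζ)) T) n x =
      ζ ^ n j • multiPow T n x := by
  induction n using multiIndex_induction with
  | zero => simp [multiPow_zero]
  | add_single n i ih =>
    rw [(hT.rotate _).multiPow_add_single_apply, hT.multiPow_add_single_apply, ih, rotate_apply,
      Finset.sum_eq_single i (fun k _ hk => by rw [Matrix.diagonal_apply_ne' _ hk, zero_smul])
        (by simp), Matrix.diagonal_apply_eq, map_smul]
    by_cases hij : i = j
    · subst hij
      simp [pow_succ, smul_smul, mul_comm]
    · simp [hij, Ne.symm hij]

/-- The part of the orbit of `x` off the `i`-th coordinate axis. -/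
def offAxisSpan (T : Fin m → H →L[ℂ] H) (x : H) (i : Fin m) : Submodule ℂ H :=
  Submodule.span ℂ {y | ∃ n : Fin m →₀ ℕ, (∃ j, j ≠ i ∧ n j ≠ 0) ∧ y = multiPow T n x}

theorem map_mem_offAxisSpan {T : Fin m → H →L[ℂ] H} (hT : IsCommuting T) (x : H) (i k : Fin m)
    {y : H} (hy : y ∈ offAxisSpan T x i) : T k y ∈ offAxisSpan T x i := by
  have h : offAxisSpan T x i ≤ (offAxisSpan T x i).comap (T k : H →ₗ[ℂ] H) := by
    refine Submodule.span_le.mpr ?_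
    rintro _ ⟨n, ⟨j, hj, hn⟩, rfl⟩
    refine Submodule.subset_span ⟨n + Finsupp.single k 1, ⟨j, hj, ?_⟩, ?_⟩
    · simp [hn]
    · exact (hT.multiPow_add_single_apply n k x).symm
  exact h hy

/-- Modulo the off-axis span, which every `T k` preserves, each factor `(T_U)_j` contributes only `U
j i • T i`. Thus `N` counts the factors and `a` is a product of entries of the `i`-th column. -/
theorem exists_multiPow_rotate_sub_mem_offAxisSpan {T : Fin m → H →L[ℂ] H} (hT : IsCommuting T)
    {U : Matrix (Fin m) (Fin m) ℂ} (i : Fin m) (hU : ∀ j, U j i ≠ 0) (x : H) (n : Fin m →₀ ℕ) :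
    ∃ (N : ℕ) (a : ℂ), a ≠ 0 ∧
      multiPow (rotate U T) n x - a • multiPow T (Finsupp.single i N) x ∈ offAxisSpan T x i := by
  induction n using multiIndex_induction with
  | zero => exact ⟨0, 1, one_ne_zero, by simp [multiPow_zero]⟩
  | add_single n j ih =>
    obtain ⟨N, a, ha, h⟩ := ih
    refine ⟨N + 1, U j i * a, mul_ne_zero (hU j) ha, ?_⟩
    set y := multiPow T (Finsupp.single i N) x with hy
    set z := multiPow (rotate U T) n x with hz
    have hrest : ∑ k ∈ Finset.univ.erase i, U j k • T k y ∈ offAxisSpan T x i := by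
      refine Submodule.sum_mem _ fun k hk => Submodule.smul_mem _ _ (Submodule.subset_span ?_)
      refine ⟨Finsupp.single i N + Finsupp.single k 1, ⟨k, Finset.ne_of_mem_erase hk, by simp⟩, ?_⟩
      rw [hT.multiPow_add_single_apply]
    have hmain : rotate U T j (z - a • y) ∈ offAxisSpan T x i := by
      rw [rotate_apply]
      exact Submodule.sum_mem _ fun k _ => Submodule.smul_mem _ _ (map_mem_offAxisSpan hT x i k h)
    have hry : rotate U T j y =
        U j i • T i y + ∑ k ∈ Finset.univ.erase i, U j k • T k y := by
      rw [rotate_apply]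
      exact (Finset.add_sum_erase _ (fun k => U j k • T k y) (Finset.mem_univ i)).symm
    rw [(hT.rotate U).multiPow_add_single_apply, Finsupp.single_add, hT.multiPow_add_single_apply,
      ← hy, ← hz]
    have : rotate U T j z - (U j i * a) • T i y =
        rotate U T j (z - a • y) + a • ∑ k ∈ Finset.univ.erase i, U j k • T k y := by
      rw [map_sub, map_smul, hry]
      module
    rw [this]
    exact Submodule.add_mem _ hmain (Submodule.smul_mem _ _ hrest)

/-! ### From sphericity to a weighted shift -/

section Spherical

variable {T : Fin m → H →L[ℂ] H} {x : H}

/-- A vector is semi-invariant for a tuple if every unitary rotation of the tuple is implemented by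
a unitary operator having the vector as an eigenvector. -/
def IsSemiInvariant (T : Fin m → H →L[ℂ] H) (x : H) : Prop :=
  ∀ U : Matrix.unitaryGroup (Fin m) ℂ, ∃ (Γ : H ≃ₗᵢ[ℂ] H) (c : ℂ), Γ x = c • x ∧ c ≠ 0 ∧
    ∀ j y, Γ (T j y) = rotate (U : Matrix (Fin m) (Fin m) ℂ) T j (Γ y)

/-- `Γ` carries the range of `T j` into the sum of the ranges of the `T k`, so `Γ⁻¹` preserves the
common orthogonal complement, which is the line spanned by `x`. -/
theorem IsSpherical.isSemiInvariant [CompleteSpace H] (hsph : IsSpherical T) (hx : x ≠ 0)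
    (hker : LinearMap.ker (columnMap (adjointTuple T)) = Submodule.span ℂ {x}) :
    IsSemiInvariant T x := by
  intro U
  obtain ⟨Γ, hΓ⟩ := hsph U
  have hmem : Γ.symm x ∈ LinearMap.ker (columnMap (adjointTuple T)) := by
    have hxk : x ∈ LinearMap.ker (columnMap (adjointTuple T)) := by
      rw [hker]
      exact Submodule.mem_span_singleton_self x
    rw [mem_ker_columnMap_adjointTuple] at hxk ⊢
    intro j y
    rw [← Γ.inner_map_map, Γ.apply_symm_apply, hΓ, rotate_apply, sum_inner]
    exact Finset.sum_eq_zero fun k _ => by rw [inner_smul_left, hxk, mul_zero]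
  rw [hker] at hmem
  obtain ⟨d, hd⟩ := Submodule.mem_span_singleton.mp hmem
  have hd0 : d ≠ 0 := by
    rintro rfl
    rw [zero_smul] at hd
    exact hx ((map_eq_zero_iff Γ.symm Γ.symm.injective).mp hd.symm)
  refine ⟨Γ, d⁻¹, ?_, inv_ne_zero hd0, hΓ⟩
  have h := congrArg Γ hd
  rw [map_smul, Γ.apply_symm_apply] at h
  rw [← h, smul_smul, inv_mul_cancel₀ hd0, one_smul, h]

/-- Multiplying only `T j` by a phase `ζ` makes the two vectors eigenvectors of one unitary, with
eigenvalues `c ζ^{n_j}` and `c ζ^{k_j}`; `ζ` is chosen to separate these. -/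
theorem IsSemiInvariant.inner_multiPow_eq_zero (hx : IsSemiInvariant T x) (hT : IsCommuting T)
    {n k : Fin m →₀ ℕ} (hnk : n ≠ k) : inner ℂ (multiPow T n x) (multiPow T k x) = 0 := by
  obtain ⟨j, hj⟩ := Finsupp.ne_iff.mp hnk
  obtain ⟨ζ, hζ, hne⟩ := exists_conj_mul_self_eq_one_and_conj_pow_mul_pow_ne_one hj
  obtain ⟨Γ, c, hc, hc0, hΓ⟩ := hx ⟨Matrix.diagonal (Function.update 1 j ζ),
    diagonal_mem_unitaryGroup fun i => by
      by_cases hij : i = j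
      · subst hij
        simpa using hζ
      · simp [hij]⟩
  have hpow : ∀ l, Γ (multiPow T l x) = c • ζ ^ l j • multiPow T l x := by
    intro l
    rw [multiPow_intertwine hT (hT.rotate _) Γ hΓ, hc, map_smul,
      multiPow_rotate_diagonal_update hT]
  have hcnorm : x ≠ 0 → conj c * c = 1 := by
    intro hx0
    have h := Γ.inner_map_map x x
    rw [hc, inner_smul_left, inner_smul_right, ← mul_assoc] at h
    exact mul_right_cancel₀ (inner_self_ne_zero.mpr hx0) (h.trans (one_mul _).symm)
  by_cases hx0 : x = 0
  · simp [hx0]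
  have h := Γ.inner_map_map (multiPow T n x) (multiPow T k x)
  rw [hpow, hpow, inner_smul_left, inner_smul_left, inner_smul_right, inner_smul_right] at h
  have h' : (conj (ζ ^ n j) * ζ ^ k j - 1) * inner ℂ (multiPow T n x) (multiPow T k x) = 0 := by
    linear_combination h - conj (ζ ^ n j) * ζ ^ k j *
      inner ℂ (multiPow T n x) (multiPow T k x) * hcnorm hx0
  exact (mul_eq_zero.mp h').resolve_left (sub_ne_zero.mpr hne)

/-- Rotating by a matrix without zero entries turns the vanishing of `T^n x` into membership of an
axis vector in the off-axis span. That vector is also orthogonal to the span, hence zero. -/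
theorem IsSemiInvariant.exists_multiPow_single_eq_zero (hx : IsSemiInvariant T x)
    (hT : IsCommuting T) {n : Fin m →₀ ℕ} (hn : multiPow T n x = 0) (i : Fin m) :
    ∃ N, multiPow T (Finsupp.single i N) x = 0 := by
  obtain ⟨U, hU⟩ := exists_mem_unitaryGroup_forall_ne_zero m
  obtain ⟨Γ, c, hc, hc0, hΓ⟩ := hx U
  obtain ⟨N, a, ha, h⟩ :=
    exists_multiPow_rotate_sub_mem_offAxisSpan hT i (fun j => hU j i) x n
  refine ⟨N, ?_⟩
  have hz : multiPow (rotate (U : Matrix (Fin m) (Fin m) ℂ) T) n x = 0 := by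
    have h := multiPow_intertwine hT (hT.rotate _) Γ hΓ n x
    rw [hn, map_zero, hc, map_smul] at h
    exact (smul_eq_zero.mp h.symm).resolve_left hc0
  rw [hz, zero_sub, neg_mem_iff, Submodule.smul_mem_iff _ ha] at h
  have hort : offAxisSpan T x i ≤ (Submodule.span ℂ {multiPow T (Finsupp.single i N) x})ᗮ := by
    refine Submodule.span_le.mpr ?_
    rintro _ ⟨k, ⟨j, hj, hk⟩, rfl⟩
    refine Submodule.mem_orthogonal_singleton_iff_inner_right.mpr (hx.inner_multiPow_eq_zero hT ?_)
    rintro rfl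
    exact hk (Finsupp.single_eq_of_ne hj)
  exact inner_self_eq_zero.mp (Submodule.mem_orthogonal_singleton_iff_inner_right.mp (hort h))

theorem IsSemiInvariant.multiPow_ne_zero (hx : IsSemiInvariant T x) (hT : IsCommuting T)
    (hH : ¬ FiniteDimensional ℂ H)
    (hcyc : (Submodule.span ℂ (Set.range fun n => multiPow T n x)).topologicalClosure = ⊤)
    (n : Fin m →₀ ℕ) : multiPow T n x ≠ 0 := by
  intro hn
  choose N hN using hx.exists_multiPow_single_eq_zero hT hn
  -- A surviving exponent lies in the box bounded by the `N i`, since a larger power of some `T i`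
  -- would kill the vector.
  have hlt : ∀ k, multiPow T k x ≠ 0 → k ≤ Finsupp.equivFunOnFinite.symm N := by
    intro k hk i
    by_contra hlt
    have hle : Finsupp.single i (N i) ≤ k := by
      rw [Finsupp.single_le_iff]
      exact (not_le.mp hlt).le
    have := hT.multiPow_add_eq_zero (hN i) (k - Finsupp.single i (N i))
    rw [add_tsub_cancel_of_le hle] at this
    exact hk this
  have hfin : (Set.range fun n => multiPow T n x).Finite := by
    refine (((Set.finite_Iic (Finsupp.equivFunOnFinite.symm N)).image
      fun n => multiPow T n x).insert 0).subset ?_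
    rintro _ ⟨k, rfl⟩
    by_cases hk : multiPow T k x = 0
    · exact Or.inl hk
    · exact Or.inr ⟨k, hlt k hk, rfl⟩
  have := FiniteDimensional.span_of_finite ℂ hfin
  rw [(Submodule.closed_of_finiteDimensional _).submodule_topologicalClosure_eq] at hcyc
  rw [hcyc] at this
  exact hH (LinearEquiv.finiteDimensional Submodule.topEquiv)

theorem IsSemiInvariant.isWeightedShift [CompleteSpace H] (hx : IsSemiInvariant T x)
    (hT : IsCommuting T) (hH : ¬ FiniteDimensional ℂ H)
    (hcyc : (Submodule.span ℂ (Set.range fun n => multiPow T n x)).topologicalClosure = ⊤) :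
    IsWeightedShift T := by
  have hne := hx.multiPow_ne_zero hT hH hcyc
  have hpos : ∀ n, 0 < ‖multiPow T n x‖ := fun n => norm_pos_iff.mpr (hne n)
  have hC : ∀ n, (‖multiPow T n x‖ : ℂ) ≠ 0 := fun n =>
    Complex.ofReal_ne_zero.mpr (hpos n).ne'
  let v : (Fin m →₀ ℕ) → H := fun n => (‖multiPow T n x‖ : ℂ)⁻¹ • multiPow T n x
  have hv : Orthonormal ℂ v := by
    refine ⟨fun n => ?_, fun n k hnk => ?_⟩
    · simp only [v, norm_smul, norm_inv, Complex.norm_real, norm_norm]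
      exact inv_mul_cancel₀ (hpos n).ne'
    · simp only [v, inner_smul_left, inner_smul_right, hx.inner_multiPow_eq_zero hT hnk, mul_zero]
  have hspan : ⊤ ≤ (Submodule.span ℂ (Set.range v)).topologicalClosure := by
    rw [← hcyc]
    refine Submodule.topologicalClosure_mono (Submodule.span_le.mpr ?_)
    rintro _ ⟨n, rfl⟩
    exact (Submodule.smul_mem_iff _ (inv_ne_zero (hC n))).mp (Submodule.subset_span ⟨n, rfl⟩)
  refine ⟨hT, HilbertBasis.mk hv hspan,
    fun j n => ‖multiPow T (n + Finsupp.single j 1) x‖ / ‖multiPow T n x‖,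
    fun j n => div_pos (hpos _) (hpos _), fun j n => ?_⟩
  rw [HilbertBasis.coe_mk]
  simp only [v]
  rw [map_smul, ← hT.multiPow_add_single_apply, smul_smul, Complex.ofReal_div, div_mul_eq_mul_div,
    mul_inv_cancel₀ (hC _), one_div]

theorem IsSpherical.isWeightedShift [CompleteSpace H] (hsph : IsSpherical T) (hT : IsCommuting T)
    (hH : ¬ FiniteDimensional ℂ H)
    (hdim : Module.finrank ℂ (LinearMap.ker (columnMap (adjointTuple T))) = 1)
    (hcyc : IsCyclicSubspace T (LinearMap.ker (columnMap (adjointTuple T)))) :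
    IsWeightedShift T := by
  obtain ⟨⟨x, hxk⟩, hx0, hspan⟩ := finrank_eq_one_iff'.mp hdim
  have hker : LinearMap.ker (columnMap (adjointTuple T)) = Submodule.span ℂ {x} := by
    refine le_antisymm (fun y hy => ?_) (Submodule.span_le.mpr (by simpa using hxk))
    obtain ⟨c, hc⟩ := hspan ⟨y, hy⟩
    exact Submodule.mem_span_singleton.mpr ⟨c, congrArg Subtype.val hc⟩
  have hx : x ≠ 0 := fun h => hx0 (Subtype.ext h)
  refine (hsph.isSemiInvariant hx hker).isWeightedShift hT hH ?_
  rw [eq_top_iff, ← hcyc.2]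
  refine Submodule.topologicalClosure_mono (Submodule.span_le.mpr ?_)
  rintro _ ⟨n, y, hy, rfl⟩
  rw [hker] at hy
  obtain ⟨c, rfl⟩ := Submodule.mem_span_singleton.mp hy
  rw [map_smul]
  exact Submodule.smul_mem _ _ (Submodule.subset_span ⟨n, rfl⟩)

end Spherical

end Hilbert

end SphericalTuple

theorem theorem2p3 {m : ℕ} {H : Type u} [NormedAddCommGroup H] [InnerProductSpace ℂ H]
    [CompleteSpace H] (hH : ¬ FiniteDimensional ℂ H) (T : Fin m → H →L[ℂ] H)
    (hcomm : SphericalTuple.IsCommuting T) (hsph : SphericalTuple.IsSpherical T) :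
    List.TFAE [
      Module.finrank ℂ
          (LinearMap.ker (SphericalTuple.columnMap (SphericalTuple.adjointTuple T))) = 1 ∧
        SphericalTuple.IsCyclicSubspace T
          (LinearMap.ker (SphericalTuple.columnMap (SphericalTuple.adjointTuple T))),
      ∃ (K : Type u) (_ : NormedAddCommGroup K) (_ : InnerProductSpace ℂ K) (_ : CompleteSpace K)
        (S : Fin m → K →L[ℂ] K),
        SphericalTuple.IsWeightedShift S ∧ SphericalTuple.UnitarilyEquivalent T S,
      ∃ (β : (Fin m →₀ ℕ) → ℝ) (hβ : ∀ n, 0 < β n)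
        (M : Fin m → SphericalTuple.H2 β hβ →L[ℂ] SphericalTuple.H2 β hβ),
        SphericalTuple.IsMultiplicationTuple M ∧ SphericalTuple.UnitarilyEquivalent T M] := by
  tfae_have 1 → 2 := fun h =>
    ⟨H, _, _, inferInstance, T, hsph.isWeightedShift hcomm hH h.1 h.2,
      LinearIsometryEquiv.refl ℂ H, fun _ _ => rfl⟩
  tfae_have 2 → 3 := by
    rintro ⟨K, _, _, _, S, hS, hTS⟩
    exact (hS.of_unitarilyEquivalent hcomm hTS).exists_isMultiplicationTuple
  tfae_have 3 → 1 := by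
    rintro ⟨β, hβ, M, hM, hTM⟩
    exact (hM.isWeightedShift.of_unitarilyEquivalent hcomm hTM).finrank_ker_and_isCyclicSubspace
  tfae_finish
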